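/- Let $d,s$ be positive integers, $p$ an odd prime, and $r$ an integer such that $d+p^s-dp^s\le r\le p^s$, $\gcd(p,d)=1$ and $p^s\equiv r\pmod d$. Write $(x)_n=x(x+1)\cdots(x+n-1)$ (with $(x)_0=1$) and $N=(p^s-r)/d$, and let $m=N$ or $m=p^s-1$. Then, modulo $p^{s+4}$, $$\sum_{k=0}^{m}(2dk+r)\frac{(r/d)_k^6}{k!^6}\equiv\frac{1}{(1)_{N}}\sum_{k=0}^{N}\frac{(2r/d)_{N}}{(2r/d)_k}\,\frac{(r/d)_k^3(1-r/d)_k}{k!^3}\bigg\{p^s-p^{3s}\sum_{j=1}^{k}\bigg(\frac{1}{(dj)^2}+\frac{1}{(dj-d+r)^2}\bigg)\bigg\}.$$ Here the quotient $(2r/d)_N/(2r/d)_k$ denotes the product $\prod_{i=k}^{N-1}\big(\tfrac{2r}{d}+i\big)$, also when $(2r/d)_k=0$ (which can happen only for $d=2$, $r<0$), and a congruence $A\equiv B\pmod{p^{e}}$ between rational numbers means that $A-B$ is $p^{e}$ times a rational number whose denominator is prime to $p$. -/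

import Mathlib

/-- The shifted factorial `(x)_n = Γ(x+n)/Γ(x) = x (x+1) ⋯ (x+n-1)` of a rational number `x`,
with `(x)_0 = 1`. -/
noncomputable def shiftedFactorial (x : ℚ) (n : ℕ) : ℚ := (ascPochhammer ℚ n).eval x

/-- The quotient `(x)_n / (x)_k` for `k ≤ n`, that is `(x+k)(x+k+1) ⋯ (x+n-1)`. It is the value at
`x` of the rational function `(X)_n / (X)_k` (a polynomial), so it also makes sense at the points
`x` where both `(x)_n` and `(x)_k` vanish. -/
noncomputable def shiftedFactorialQuot (x : ℚ) (n k : ℕ) : ℚ := shiftedFactorial (x + k) (n - k)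

/-- Wherever `(x)_k ≠ 0`, `shiftedFactorialQuot x n k` is the literal quotient. -/
theorem shiftedFactorialQuot_eq_div {x : ℚ} {n k : ℕ} (hk : k ≤ n)
    (hx : shiftedFactorial x k ≠ 0) :
    shiftedFactorialQuot x n k = shiftedFactorial x n / shiftedFactorial x k := by
  rw [eq_div_iff hx]
  have h := congrArg (Polynomial.eval x) (ascPochhammer_mul ℚ k (n - k))
  rw [Nat.add_sub_cancel' hk] at h
  simp only [Polynomial.eval_mul, Polynomial.eval_comp, Polynomial.eval_add, Polynomial.eval_X,
    Polynomial.eval_natCast] at h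
  rw [shiftedFactorialQuot, shiftedFactorial, shiftedFactorial, shiftedFactorial, ← h, mul_comm]

/-- For a prime `p`: the congruence `a ≡ b (mod p ^ e)` of rational numbers, that is
`a - b ∈ p ^ e ℤ_(p)`: the difference is `p ^ e` times a fraction with denominator prime to `p`. -/
def RatCongr (p e : ℕ) (a b : ℚ) : Prop :=
  ∃ u v : ℤ, ¬ (p : ℤ) ∣ v ∧ a - b = (p : ℚ) ^ e * ((u : ℚ) / (v : ℚ))

/-!
Put `a = r / d` and `t = p ^ s / d`, so that `a + N = t`. Let `F k = (a)_k² / k!²` and let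
`G k = (a + t)_k (a - t)_k / ((1 + t)_k (1 - t)_k)`, which vanishes for `k > N` and tends to `F` as
`t → 0`. By the Pfaff–Saalschütz theorem both are combinations of the functions
`b_i x = (-x)_i (a + x)_i / i!²`, with `p`-integral coefficients that agree modulo `p²`. The
integral combinations of the `b_i` form a ring, and `∑_{k < n} (2 k + a) b_i k` has a closed form
that is divisible by `p ^ s` for `n = N + 1` and for `n = p ^ s`. In
`F³ = F (F - G)² + F G (2 F - G)` the first term therefore contributes `0` modulo `p ^ (s + 4)`.
The second one stops at `k = N`; expanding `2 F - G` in the `b_i` reduces it to sums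
`∑ (2 k + a) F G b_i`, which satisfy a first-order recurrence in `i`. To first order in `t²` their
values give the right-hand side.
-/

/-- The rising factorial `(x)_n = x (x + 1) ⋯ (x + n - 1)` in an arbitrary commutative ring. Over
`ℚ` it is definitionally `shiftedFactorial`; the proof evaluates it in `ℚ_[p]`. -/
noncomputable def risingFactorial {R : Type*} [CommRing R] (x : R) (n : ℕ) : R :=
  (ascPochhammer R n).eval x

section RisingFactorial

variable {R : Type*} [CommRing R]

theorem risingFactorial_zero (x : R) : risingFactorial x 0 = 1 := by
  simp [risingFactorial]

theorem risingFactorial_succ (x : R) (n : ℕ) :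
    risingFactorial x (n + 1) = risingFactorial x n * (x + n) :=
  ascPochhammer_succ_eval n x

theorem risingFactorial_eq_prod (x : R) (n : ℕ) :
    risingFactorial x n = ∏ j ∈ Finset.range n, (x + j) := by
  induction n with
  | zero => simp [risingFactorial_zero]
  | succ n ih => rw [risingFactorial_succ, ih, Finset.prod_range_succ]

theorem risingFactorial_succ_left (x : R) (n : ℕ) :
    risingFactorial x (n + 1) = x * risingFactorial (x + 1) n := by
  simp [risingFactorial, ascPochhammer_succ_left]

theorem risingFactorial_one (n : ℕ) : risingFactorial (1 : R) n = n.factorial :=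
  ascPochhammer_eval_one R n

theorem risingFactorial_neg_natCast_eq_zero {k n : ℕ} (h : k < n) :
    risingFactorial (-(k : R)) n = 0 :=
  ascPochhammer_eval_neg_coe_nat_of_lt h

theorem risingFactorial_reflect (x : R) (n : ℕ) :
    risingFactorial x n = (-1) ^ n * risingFactorial (1 - n - x) n := by
  induction n generalizing x with
  | zero => simp [risingFactorial_zero]
  | succ n ih =>
    rw [risingFactorial_succ_left, ih, risingFactorial_succ (1 - _ - x),
      show 1 - ((n + 1 : ℕ) : R) - x = 1 - n - (x + 1) by push_cast; ring]
    ring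

theorem prod_sq_sub_sq (x t : R) (n : ℕ) :
    ∏ j ∈ Finset.range n, ((x + j) ^ 2 - t ^ 2) =
      risingFactorial (x + t) n * risingFactorial (x - t) n := by
  rw [risingFactorial_eq_prod, risingFactorial_eq_prod, ← Finset.prod_mul_distrib]
  exact Finset.prod_congr rfl fun j _ => by ring

end RisingFactorial

section WellPoised

variable {K : Type*} [Field K]

/-- The functions `(-x)_i (a + x)_i / i!²`, polynomials in `x (x + a)`: the basis in which the
factors of a very-well-poised series, whose weight is `2 x + a`, are expanded. -/
noncomputable def wellPoised (a : K) (i : ℕ) (x : K) : K :=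
  risingFactorial (-x) i * risingFactorial (a + x) i / (i.factorial : K) ^ 2

/-- The ratio `(a + t)_k (a - t)_k / ((1 + t)_k (1 - t)_k)`, in terms of `y = t²`. -/
noncomputable def poisedRatio (a y : K) (k : ℕ) : K :=
  ∏ j ∈ Finset.range k, ((a + j) ^ 2 - y) / ((1 + j) ^ 2 - y)

/-- The coefficient `(1 - a)_i i! / ((1 + t)_i (1 - t)_i)`, with `y = t²`, of `wellPoised a i` in
the Pfaff–Saalschütz expansion of `poisedRatio a y`. -/
noncomputable def saalCoeff (a y : K) (i : ℕ) : K :=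
  ∏ j ∈ Finset.range i, (1 - a + j) * (1 + j) / ((1 + j) ^ 2 - y)

theorem wellPoised_zero (a x : K) : wellPoised a 0 x = 1 := by
  simp [wellPoised, risingFactorial_zero]

theorem wellPoised_natCast_eq_zero (a : K) {i k : ℕ} (h : k < i) : wellPoised a i k = 0 := by
  simp [wellPoised, risingFactorial_neg_natCast_eq_zero h]

theorem poisedRatio_eq_zero {a t : K} {N k : ℕ} (ht : a + N = t) (h : N < k) :
    poisedRatio a (t ^ 2) k = 0 :=
  Finset.prod_eq_zero (Finset.mem_range.2 h) (by rw [ht, sub_self, zero_div])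

theorem poisedRatio_zero_right (a : K) (k : ℕ) :
    poisedRatio a 0 k = (risingFactorial a k / (k.factorial : K)) ^ 2 := by
  simp only [poisedRatio, sub_zero, ← div_pow, Finset.prod_pow, Finset.prod_div_distrib,
    ← risingFactorial_eq_prod, risingFactorial_one]

theorem poisedRatio_succ {a y : K} {k : ℕ} (h : (1 + k) ^ 2 - y ≠ 0) :
    poisedRatio a y (k + 1) * ((1 + k) ^ 2 - y) = poisedRatio a y k * ((a + k) ^ 2 - y) := by
  rw [poisedRatio, Finset.prod_range_succ, mul_assoc, div_mul_cancel₀ _ h, ← poisedRatio]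

theorem saalCoeff_succ {a y : K} {i : ℕ} (h : (1 + i) ^ 2 - y ≠ 0) :
    saalCoeff a y (i + 1) * ((1 + i) ^ 2 - y) = saalCoeff a y i * ((1 - a + i) * (1 + i)) := by
  rw [saalCoeff, Finset.prod_range_succ, mul_assoc, div_mul_cancel₀ _ h, ← saalCoeff]

theorem wellPoised_add_one (a x : K) (i : ℕ) :
    wellPoised a i (x + 1) * ((x + 1 - i) * (a + x)) =
      wellPoised a i x * ((x + 1) * (a + x + i)) := by
  have hneg : -(x + 1) * risingFactorial (-x) i =
      risingFactorial (-(x + 1)) i * (-(x + 1) + i) := by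
    rw [← risingFactorial_succ, risingFactorial_succ_left]
    ring_nf
  have hadd : (a + x) * risingFactorial (a + (x + 1)) i =
      risingFactorial (a + x) i * (a + x + i) := by
    rw [← risingFactorial_succ, risingFactorial_succ_left, add_assoc]
  rw [wellPoised, wellPoised, div_mul_eq_mul_div, div_mul_eq_mul_div]
  congr 1
  linear_combination (x + 1) * risingFactorial (-x) i * hadd +
    (a + x) * risingFactorial (a + (x + 1)) i * hneg

variable [CharZero K]

theorem wellPoised_succ (a x : K) (i : ℕ) :
    (i + 1) ^ 2 * wellPoised a (i + 1) x = wellPoised a i x * ((i - x) * (a + x + i)) := by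
  simp only [wellPoised, risingFactorial_succ, Nat.factorial_succ]
  push_cast
  field

theorem wellPoised_succ_add_one (a x : K) (n : ℕ) :
    (n + 1) ^ 2 * wellPoised a (n + 1) (x + 1) = -((x + 1) * (a + x + 1 + n)) *
      (risingFactorial (-x) n * risingFactorial (a + x + 1) n / (n.factorial : K) ^ 2) := by
  rw [wellPoised, risingFactorial_succ_left, risingFactorial_succ, Nat.factorial_succ,
    show -(x + 1) + 1 = -x by ring, ← add_assoc]
  push_cast
  field

theorem wellPoised_succ_eq (a x : K) (n : ℕ) :
    (n + 1) ^ 2 * wellPoised a (n + 1) x = (n - x) * (a + x) *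
      (risingFactorial (-x) n * risingFactorial (a + x + 1) n / (n.factorial : K) ^ 2) := by
  rw [wellPoised, risingFactorial_succ, risingFactorial_succ_left (a + x), Nat.factorial_succ]
  push_cast
  field

theorem sum_saalCoeff_mul_wellPoised_telescope {a y : K} (x : K) (n : ℕ)
    (hy : ∀ j < n, (1 + j : K) ^ 2 - y ≠ 0) :
    ∑ i ∈ Finset.range (n + 1), (((1 + x) ^ 2 - y) * (saalCoeff a y i * wellPoised a i (x + 1)) -
      ((a + x) ^ 2 - y) * (saalCoeff a y i * wellPoised a i x)) =
    (2 * x + 1 + a) * (risingFactorial (-x) n * risingFactorial (a + x + 1) n /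
      (n.factorial : K) ^ 2 * (saalCoeff a y n * (1 - a + n))) := by
  induction n with
  | zero =>
    simp only [zero_add, Finset.sum_range_one, wellPoised_zero, saalCoeff, Finset.prod_range_zero,
      risingFactorial_zero, Nat.factorial_zero, Nat.cast_zero, Nat.cast_one]
    ring
  | succ n ih =>
    set B : ℕ → K := fun n =>
      risingFactorial (-x) n * risingFactorial (a + x + 1) n / (n.factorial : K) ^ 2 with hB
    have hn : (n + 1 : K) ≠ 0 := n.cast_add_one_ne_zero
    have hcoeff := saalCoeff_succ (a := a) (hy n n.lt_succ_self)
    have hshift : (n + 1) ^ 2 * wellPoised a (n + 1) (x + 1) =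
        -((x + 1) * (a + x + 1 + n)) * B n := wellPoised_succ_add_one a x n
    have hsame : (n + 1) ^ 2 * wellPoised a (n + 1) x = (n - x) * (a + x) * B n :=
      wellPoised_succ_eq a x n
    have hBsucc : (n + 1) ^ 2 * B (n + 1) = (n - x) * (a + x + 1 + n) * B n := by
      simp only [hB, risingFactorial_succ, Nat.factorial_succ]
      push_cast
      field
    rw [Finset.sum_range_succ, ih fun j hj => hy j (by omega)]
    apply mul_left_cancel₀ (pow_ne_zero 2 hn)
    push_cast
    linear_combination ((1 + x) ^ 2 - y) * saalCoeff a y (n + 1) * hshift -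
      ((a + x) ^ 2 - y) * saalCoeff a y (n + 1) * hsame -
      (2 * x + 1 + a) * saalCoeff a y (n + 1) * (1 - a + (n + 1)) * hBsucc -
      (2 * x + 1 + a) * B n * (n + 1) * hcoeff

theorem poisedRatio_eq_sum {a y : K} {k n : ℕ} (hkn : k < n)
    (hy : ∀ j, j + 1 < n → (1 + j : K) ^ 2 - y ≠ 0) :
    poisedRatio a y k = ∑ i ∈ Finset.range n, saalCoeff a y i * wellPoised a i k := by
  induction k with
  | zero =>
    rw [Finset.sum_eq_single_of_mem 0 (by simpa using hkn)
      fun i _ hi => by rw [wellPoised_natCast_eq_zero a (by omega), mul_zero]]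
    simp [poisedRatio, wellPoised_zero, saalCoeff]
  | succ k ih =>
    obtain ⟨n, rfl⟩ : ∃ l, n = l + 1 := ⟨n - 1, by omega⟩
    have htelescope := sum_saalCoeff_mul_wellPoised_telescope (a := a) (k : K) n
      fun j hj => hy j (by omega)
    rw [Finset.sum_sub_distrib, ← Finset.mul_sum, ← Finset.mul_sum, ← ih (by omega),
      risingFactorial_neg_natCast_eq_zero (by omega : k < n)] at htelescope
    have hk := hy k (by omega)
    apply mul_right_cancel₀ hk
    rw [poisedRatio_succ hk]
    push_cast
    linear_combination -htelescope

theorem sum_weight_mul_wellPoised (a : K) (i n : ℕ) :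
    ∑ k ∈ Finset.range n, (2 * k + a) * wellPoised a i k =
      -(risingFactorial (-(n : K)) (i + 1) * risingFactorial (a + n - 1) (i + 1) /
        ((i.factorial : K) * ((i + 1).factorial : K))) := by
  induction n with
  | zero => simp [risingFactorial_succ_left]
  | succ n ih =>
    have hneg : risingFactorial (-((n + 1 : ℕ) : K)) (i + 1) =
        -(n + 1) * risingFactorial (-(n : K)) i := by
      rw [risingFactorial_succ_left]
      push_cast
      ring_nf
    have hadd : risingFactorial (a + n - 1) (i + 1) =
        (a + n - 1) * risingFactorial (a + n) i := by
      rw [risingFactorial_succ_left, sub_add_cancel]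
    rw [Finset.sum_range_succ, ih, wellPoised, hneg, hadd,
      show a + ((n + 1 : ℕ) : K) - 1 = a + n by push_cast; ring]
    simp only [risingFactorial_succ, Nat.factorial_succ]
    push_cast
    field

/-- The coefficient of `wellPoised a (i + h)` in `wellPoised a i * wellPoised a (h + g)`. -/
noncomputable def wellPoisedMulCoeff (a : K) (i h g : ℕ) : K :=
  (-1) ^ g * (i + h).choose h * (i + h).choose (h + g) *
    (risingFactorial (a + i + h) g / (g.factorial : K))

theorem wellPoisedMulCoeff_succ_left (a : K) (i h g : ℕ) :
    (h + 1) * (h + 1 + g) * wellPoisedMulCoeff (a - 1) i (h + 1) g =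
      (i + h + 1) ^ 2 * wellPoisedMulCoeff a i h g := by
  have hchoose (l : ℕ) : (l + 1 : K) * (i + h + 1).choose (l + 1) =
      (i + h + 1) * (i + h).choose l := by
    exact_mod_cast (mul_comm _ _).trans (Nat.add_one_mul_choose_eq (i + h) l).symm
  have h₁ := hchoose h
  have h₂ := hchoose (h + g)
  rw [wellPoisedMulCoeff, wellPoisedMulCoeff, ← add_assoc i h 1, add_right_comm h 1 g,
    show a - 1 + i + ((h + 1 : ℕ) : K) = a + i + h by push_cast; ring]
  push_cast at h₂ ⊢
  linear_combination (-1) ^ g * (risingFactorial (a + i + h) g / (g.factorial : K)) *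
    ((h + 1 + g) * (i + h + 1).choose (h + g + 1) * h₁ + (i + h + 1) * (i + h).choose h * h₂)

theorem wellPoisedMulCoeff_succ_right (a : K) (i h g : ℕ) :
    (h + g + 1) ^ 2 * wellPoisedMulCoeff a i h (g + 1) =
      h * (h + g + 1) * wellPoisedMulCoeff (a - 1) i h (g + 1) +
        (g - i) * (a + i + h + h + g) * wellPoisedMulCoeff a i h g := by
  have hchoose : (h + g + 1 : K) * (i + h).choose (h + g + 1) =
      (i - g) * (i + h).choose (h + g) := by
    have hc := congrArg (Nat.cast (R := K)) (Nat.choose_succ_right_eq (i + h) (h + g))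
    rcases le_or_gt (h + g) (i + h) with hle | hlt
    · push_cast [Nat.cast_sub hle] at hc
      linear_combination hc
    · simp [Nat.choose_eq_zero_of_lt hlt, Nat.choose_eq_zero_of_lt (hlt.trans (Nat.lt_succ_self _))]
  have hr : (g + 1) * (risingFactorial (a + i + h) (g + 1) / ((g + 1).factorial : K)) =
      (a + i + h + g) * (risingFactorial (a + i + h) g / (g.factorial : K)) := by
    rw [risingFactorial_succ, Nat.factorial_succ]
    push_cast
    field
  have hl : (g + 1) * (risingFactorial (a - 1 + i + h) (g + 1) / ((g + 1).factorial : K)) =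
      (a + i + h - 1) * (risingFactorial (a + i + h) g / (g.factorial : K)) := by
    rw [risingFactorial_succ_left, Nat.factorial_succ, show a - 1 + i + h = a + i + h - 1 by ring,
      sub_add_cancel]
    push_cast
    field
  apply mul_left_cancel₀ (g.cast_add_one_ne_zero : (g + 1 : K) ≠ 0)
  simp only [wellPoisedMulCoeff, ← add_assoc]
  linear_combination (-1) ^ (g + 1) * (i + h).choose h * (i + h).choose (h + g + 1) *
    (h + g + 1) * ((h + g + 1) * hr - h * hl) - (-1) ^ g * (i + h).choose h * (g + 1) *
    (risingFactorial (a + i + h) g / (g.factorial : K)) * (a + i + h + h + g) * hchoose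

open Finset.HasAntidiagonal in
theorem sum_wellPoisedMulCoeff_succ_left (a : K) (w : ℕ → K) (i j : ℕ) :
    ∑ q ∈ antidiagonal (j + 1),
        q.1 * (q.1 + q.2) * wellPoisedMulCoeff (a - 1) i q.1 q.2 * w q.1 =
      ∑ q ∈ antidiagonal j,
        (i + q.1 + 1) ^ 2 * wellPoisedMulCoeff a i q.1 q.2 * w (q.1 + 1) := by
  rw [Finset.Nat.sum_antidiagonal_succ]
  simp only [Nat.cast_zero, zero_mul, zero_add]
  refine Finset.sum_congr rfl fun q _ => ?_
  push_cast
  rw [wellPoisedMulCoeff_succ_left]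

open Finset.HasAntidiagonal in
theorem sum_wellPoisedMulCoeff_succ_right (a : K) (w : ℕ → K) (i j : ℕ) :
    ∑ q ∈ antidiagonal (j + 1), (q.1 + q.2) ^ 2 * wellPoisedMulCoeff a i q.1 q.2 * w q.1 =
      ∑ q ∈ antidiagonal (j + 1),
        q.1 * (q.1 + q.2) * wellPoisedMulCoeff (a - 1) i q.1 q.2 * w q.1 +
      ∑ q ∈ antidiagonal j,
        (q.2 - i) * (a + i + q.1 + q.1 + q.2) * wellPoisedMulCoeff a i q.1 q.2 * w q.1 := by
  have hzero : ((j + 1 : ℕ) + (0 : ℕ) : K) ^ 2 * wellPoisedMulCoeff a i (j + 1) 0 -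
      (j + 1 : ℕ) * ((j + 1 : ℕ) + (0 : ℕ)) * wellPoisedMulCoeff (a - 1) i (j + 1) 0 = 0 := by
    simp only [wellPoisedMulCoeff, risingFactorial_zero]
    push_cast
    ring
  rw [← sub_eq_iff_eq_add', ← Finset.sum_sub_distrib]
  simp only [← sub_mul]
  rw [Finset.Nat.sum_antidiagonal_succ', hzero, zero_mul, zero_add]
  refine Finset.sum_congr rfl fun q _ => ?_
  push_cast
  linear_combination w q.1 * wellPoisedMulCoeff_succ_right a i q.1 q.2

open Finset.HasAntidiagonal in
theorem wellPoised_mul (a x : K) (i j : ℕ) :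
    wellPoised a i x * wellPoised a j x = ∑ q ∈ antidiagonal j,
      wellPoisedMulCoeff a i q.1 q.2 * wellPoised a (i + q.1) x := by
  induction j with
  | zero => simp [wellPoised_zero, wellPoisedMulCoeff, risingFactorial_zero]
  | succ j ih =>
    have hleft := sum_wellPoisedMulCoeff_succ_left a (fun h => wellPoised a (i + h) x) i j
    have hright := sum_wellPoisedMulCoeff_succ_right a (fun h => wellPoised a (i + h) x) i j
    have hj : (j + 1 : K) ≠ 0 := j.cast_add_one_ne_zero
    apply mul_left_cancel₀ (pow_ne_zero 2 hj)
    calc (j + 1) ^ 2 * (wellPoised a i x * wellPoised a (j + 1) x)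
        = wellPoised a i x * wellPoised a j x * ((j - x) * (a + x + j)) := by
          rw [mul_left_comm, wellPoised_succ, mul_assoc]
      _ = ∑ q ∈ antidiagonal (j + 1),
          (q.1 + q.2 : K) ^ 2 * wellPoisedMulCoeff a i q.1 q.2 * wellPoised a (i + q.1) x := by
        rw [hright, hleft, ih, Finset.sum_mul, ← Finset.sum_add_distrib]
        refine Finset.sum_congr rfl fun q hq => ?_
        rw [← mem_antidiagonal.1 hq]
        have hsucc := wellPoised_succ a x (i + q.1)
        push_cast [add_assoc] at hsucc ⊢
        linear_combination -wellPoisedMulCoeff a i q.1 q.2 * hsucc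
      _ = _ := by
        rw [Finset.mul_sum]
        refine Finset.sum_congr rfl fun q hq => ?_
        have hq' : (q.1 + q.2 : K) = j + 1 := by exact_mod_cast mem_antidiagonal.1 hq
        rw [hq', mul_assoc]

theorem sum_weight_mul_poisedRatio_telescope {a y : K} (i n : ℕ) (ha : ∀ j < n, a + j ≠ 0)
    (hy : ∀ j < n, (1 + j : K) ^ 2 - y ≠ 0) :
    ∑ k ∈ Finset.range n, (2 * k + a) * (poisedRatio a 0 k * poisedRatio a y k) *
      (wellPoised a i k *
        ((2 * a + i) * ((i - k) * (a + k + i)) - (a + i) * ((a + i) ^ 2 - y))) =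
    -(poisedRatio a 0 n * poisedRatio a y n * wellPoised a i n *
      (n * (n ^ 2 - y) * (n - i))) := by
  induction n with
  | zero => simp
  | succ n ih =>
    have hn : (1 + n : K) ≠ 0 := by rw [add_comm]; exact n.cast_add_one_ne_zero
    have hF := poisedRatio_succ (a := a) (y := 0) (k := n) (by simpa using hn)
    have hG := poisedRatio_succ (a := a) (hy n n.lt_succ_self)
    have hb := wellPoised_add_one a (n : K) i
    have hstep : poisedRatio a 0 (n + 1) * poisedRatio a y (n + 1) * wellPoised a i (n + 1) *
        ((n + 1) * ((n + 1) ^ 2 - y) * (n + 1 - i)) =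
        poisedRatio a 0 n * poisedRatio a y n * wellPoised a i n *
          ((a + n) * ((a + n) ^ 2 - y) * (a + n + i)) := by
      apply mul_right_cancel₀ (mul_ne_zero hn (ha n n.lt_succ_self))
      linear_combination poisedRatio a y (n + 1) * wellPoised a i (n + 1) *
          ((n + 1 - i) * (a + n)) * ((1 + n) ^ 2 - y) * hF +
        poisedRatio a 0 n * (a + n) ^ 2 * wellPoised a i (n + 1) *
          ((n + 1 - i) * (a + n)) * hG +
        poisedRatio a 0 n * poisedRatio a y n * (a + n) ^ 2 * ((a + n) ^ 2 - y) * hb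
    rw [Finset.sum_range_succ, ih (fun j hj => ha j (by omega)) fun j hj => hy j (by omega)]
    push_cast
    linear_combination hstep

theorem sum_weight_mul_poisedRatio_rec {a t : K} {N : ℕ} (ht : a + N = t) (ha : ∀ j < N, a + j ≠ 0)
    (hy : ∀ j < N, (1 + j : K) ^ 2 - t ^ 2 ≠ 0) (i : ℕ) :
    (2 * a + i) * (i + 1) ^ 2 * ∑ k ∈ Finset.range (N + 1),
        (2 * k + a) * (poisedRatio a 0 k * poisedRatio a (t ^ 2) k) * wellPoised a (i + 1) k =
      (a + i) * ((a + i) ^ 2 - t ^ 2) * ∑ k ∈ Finset.range (N + 1),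
        (2 * k + a) * (poisedRatio a 0 k * poisedRatio a (t ^ 2) k) * wellPoised a i k := by
  have htelescope := sum_weight_mul_poisedRatio_telescope i N ha hy
  rw [← sub_eq_zero, Finset.mul_sum, Finset.mul_sum, ← Finset.sum_sub_distrib]
  have hterm (k : ℕ) := wellPoised_succ a (k : K) i
  calc _ = ∑ k ∈ Finset.range (N + 1), (2 * k + a) * (poisedRatio a 0 k * poisedRatio a (t ^ 2) k) *
        (wellPoised a i k *
          ((2 * a + i) * ((i - k) * (a + k + i)) - (a + i) * ((a + i) ^ 2 - t ^ 2))) :=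
        Finset.sum_congr rfl fun k _ => by
          linear_combination (2 * a + i) * (2 * k + a) *
            (poisedRatio a 0 k * poisedRatio a (t ^ 2) k) * hterm k
    _ = 0 := by
        rw [Finset.sum_range_succ, htelescope, ← ht]
        ring

theorem sum_weight_mul_poisedRatio_top {a t : K} {N : ℕ} (ht : a + N = t)
    (hy : ∀ j < N, (1 + j : K) ^ 2 - t ^ 2 ≠ 0) :
    ∑ k ∈ Finset.range (N + 1),
        (2 * k + a) * (poisedRatio a 0 k * poisedRatio a (t ^ 2) k) * wellPoised a N k =
      t / N.factorial * (risingFactorial a N *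
        (∏ j ∈ Finset.range N, ((a + j) ^ 2 - t ^ 2)) / (N.factorial : K) ^ 2) := by
  have hden : ∏ j ∈ Finset.range N, ((1 + j : K) ^ 2 - t ^ 2) ≠ 0 :=
    Finset.prod_ne_zero_iff.2 fun j hj => hy j (Finset.mem_range.1 hj)
  rw [prod_sq_sub_sq] at hden
  obtain ⟨hplus, hminus⟩ := mul_ne_zero_iff.1 hden
  have hN : risingFactorial (-(N : K)) N = (-1) ^ N * N.factorial := by
    rw [risingFactorial_reflect, sub_neg_eq_add, sub_add_cancel, risingFactorial_one]
  have ha : risingFactorial a N = (-1) ^ N * risingFactorial (1 - t) N := by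
    rw [risingFactorial_reflect, ← ht, sub_sub, add_comm (N : K)]
  have htN : (t + N) * risingFactorial t N = t * risingFactorial (1 + t) N := by
    rw [mul_comm, ← risingFactorial_succ, risingFactorial_succ_left, add_comm t 1]
  have hsign : (-1 : K) ^ N * (-1) ^ N = 1 := by rw [← mul_pow]; norm_num
  rw [Finset.sum_range_succ, Finset.sum_eq_zero fun k hk => by
    rw [wellPoised_natCast_eq_zero a (Finset.mem_range.1 hk), mul_zero], zero_add,
    poisedRatio_zero_right, poisedRatio, Finset.prod_div_distrib, prod_sq_sub_sq 1, wellPoised, hN,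
    ht, ha, show 2 * (N : K) + a = t + N by rw [← ht]; ring]
  calc _ = (t + N) * risingFactorial t N * ((-1) ^ N * (-1) ^ N * (-1) ^ N *
          risingFactorial (1 - t) N * (∏ j ∈ Finset.range N, ((a + j) ^ 2 - t ^ 2)) /
            ((N.factorial : K) ^ 3 * risingFactorial (1 + t) N)) := by field
    _ = _ := by
      rw [htN, hsign]
      field

theorem sum_weight_mul_poisedRatio {a t : K} {N : ℕ} (ht : a + N = t) (ha : ∀ j < N, a + j ≠ 0)
    (hat : ∀ j < N, (a + j) ^ 2 - t ^ 2 ≠ 0) (hy : ∀ j < N, (1 + j : K) ^ 2 - t ^ 2 ≠ 0)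
    {i : ℕ} (hi : i ≤ N) :
    ∑ k ∈ Finset.range (N + 1),
        (2 * k + a) * (poisedRatio a 0 k * poisedRatio a (t ^ 2) k) * wellPoised a i k =
      t / N.factorial * (risingFactorial (2 * a + i) (N - i) * (risingFactorial a i *
        (∏ j ∈ Finset.range i, ((a + j) ^ 2 - t ^ 2)) / (i.factorial : K) ^ 2)) := by
  induction hi using Nat.decreasingInduction with
  | self => rw [sum_weight_mul_poisedRatio_top ht hy, Nat.sub_self, risingFactorial_zero, one_mul]
  | of_succ i hi ih =>
    apply mul_left_cancel₀ (mul_ne_zero (ha i hi) (hat i hi))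
    rw [← sum_weight_mul_poisedRatio_rec ht ha hy, ih]
    obtain ⟨l, rfl⟩ : ∃ l, N = i + 1 + l := ⟨N - (i + 1), by omega⟩
    rw [show i + 1 + l - (i + 1) = l by omega, show i + 1 + l - i = l + 1 by omega,
      risingFactorial_succ_left (2 * a + i), risingFactorial_succ a, Finset.prod_range_succ,
      Nat.factorial_succ, show 2 * a + ((i + 1 : ℕ) : K) = 2 * a + i + 1 by push_cast; ring]
    have hi' : (i + 1 : K) ≠ 0 := i.cast_add_one_ne_zero
    push_cast
    field

theorem saalCoeff_zero_right (a : K) (i : ℕ) :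
    saalCoeff a 0 i = risingFactorial (1 - a) i / i.factorial := by
  rw [← risingFactorial_one (R := K), risingFactorial_eq_prod, risingFactorial_eq_prod,
    ← Finset.prod_div_distrib, saalCoeff]
  refine Finset.prod_congr rfl fun j _ => ?_
  have hj : (1 + j : K) ≠ 0 := by rw [add_comm]; exact j.cast_add_one_ne_zero
  field

theorem saalCoeff_eq_mul_inv_prod (a y : K) (i : ℕ) :
    saalCoeff a y i =
      saalCoeff a 0 i * (∏ j ∈ Finset.range i, (1 - y / (1 + j) ^ 2))⁻¹ := by
  rw [saalCoeff, saalCoeff, ← Finset.prod_inv_distrib, ← Finset.prod_mul_distrib]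
  refine Finset.prod_congr rfl fun j _ => ?_
  have hj : (1 + j : K) ≠ 0 := by rw [add_comm]; exact j.cast_add_one_ne_zero
  rw [one_sub_div (pow_ne_zero 2 hj), inv_div, sub_zero]
  field

/-- The `i`-th summand of the truncated series on the right-hand side, without its braces. -/
noncomputable def truncTerm (a : K) (N i : ℕ) : K :=
  risingFactorial (2 * a + i) (N - i) *
    (risingFactorial a i ^ 3 * risingFactorial (1 - a) i / (i.factorial : K) ^ 3) / N.factorial

theorem two_mul_saalCoeff_sub_mul_eq {a t : K} (N : ℕ) {i : ℕ} (ha : ∀ j < i, a + j ≠ 0) :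
    (2 * saalCoeff a 0 i - saalCoeff a (t ^ 2) i) *
      (t / N.factorial * (risingFactorial (2 * a + i) (N - i) * (risingFactorial a i *
        (∏ j ∈ Finset.range i, ((a + j) ^ 2 - t ^ 2)) / (i.factorial : K) ^ 2))) =
    t * (truncTerm a N i *
      ((2 - (∏ j ∈ Finset.range i, (1 - t ^ 2 / (1 + j) ^ 2))⁻¹) *
        ∏ j ∈ Finset.range i, (1 - t ^ 2 / (a + j) ^ 2))) := by
  have hprod : ∏ j ∈ Finset.range i, ((a + j) ^ 2 - t ^ 2) =
      risingFactorial a i ^ 2 * ∏ j ∈ Finset.range i, (1 - t ^ 2 / (a + j) ^ 2) := by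
    rw [risingFactorial_eq_prod, ← Finset.prod_pow, ← Finset.prod_mul_distrib]
    refine Finset.prod_congr rfl fun j hj => ?_
    rw [mul_one_sub, mul_div_cancel₀ _ (pow_ne_zero 2 (ha j (Finset.mem_range.1 hj)))]
  rw [hprod, saalCoeff_eq_mul_inv_prod a (t ^ 2), saalCoeff_zero_right, truncTerm]
  ring

theorem sum_weight_mul_poisedRatio_mul_two_sub {a t : K} {N n : ℕ} (ht : a + N = t) (hNn : N < n)
    (ha : ∀ j < N, a + j ≠ 0) (hat : ∀ j < N, (a + j) ^ 2 - t ^ 2 ≠ 0)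
    (hy : ∀ j < N, (1 + j : K) ^ 2 - t ^ 2 ≠ 0) :
    ∑ k ∈ Finset.range n, (2 * k + a) * (poisedRatio a 0 k * poisedRatio a (t ^ 2) k) *
        (2 * poisedRatio a 0 k - poisedRatio a (t ^ 2) k) =
      ∑ i ∈ Finset.range (N + 1), t * (truncTerm a N i *
        ((2 - (∏ j ∈ Finset.range i, (1 - t ^ 2 / (1 + j) ^ 2))⁻¹) *
          ∏ j ∈ Finset.range i, (1 - t ^ 2 / (a + j) ^ 2))) := by
  have hexpand : ∀ k ∈ Finset.range (N + 1),
      2 * poisedRatio a 0 k - poisedRatio a (t ^ 2) k = ∑ i ∈ Finset.range (N + 1),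
        (2 * saalCoeff a 0 i - saalCoeff a (t ^ 2) i) * wellPoised a i k := fun k hk => by
    have hk := Finset.mem_range.1 hk
    rw [poisedRatio_eq_sum hk fun j _ => by
        rw [sub_zero, add_comm]; exact pow_ne_zero 2 j.cast_add_one_ne_zero,
      poisedRatio_eq_sum hk fun j hj => hy j (by omega), Finset.mul_sum, ← Finset.sum_sub_distrib]
    exact Finset.sum_congr rfl fun i _ => by ring
  rw [← Finset.sum_subset (Finset.range_mono hNn) fun k _ hk => by
    rw [poisedRatio_eq_zero ht (by simpa using hk), mul_zero, mul_zero, zero_mul]]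
  calc _ = ∑ k ∈ Finset.range (N + 1), ∑ i ∈ Finset.range (N + 1),
        (2 * saalCoeff a 0 i - saalCoeff a (t ^ 2) i) *
          ((2 * k + a) * (poisedRatio a 0 k * poisedRatio a (t ^ 2) k) * wellPoised a i k) :=
        Finset.sum_congr rfl fun k hk => by
          rw [hexpand k hk, Finset.mul_sum]
          exact Finset.sum_congr rfl fun i _ => by ring
    _ = _ := by
        rw [Finset.sum_comm]
        refine Finset.sum_congr rfl fun i hi => ?_
        have hiN := Finset.mem_range_succ_iff.1 hi
        rw [← Finset.mul_sum, sum_weight_mul_poisedRatio ht ha hat hy hiN,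
          two_mul_saalCoeff_sub_mul_eq N fun j hj => ha j (hj.trans_le hiN)]

end WellPoised

section Ultrametric

variable {K ι : Type*} [NormedField K]

theorem sq_sub_sq_ne_zero_of_norm_lt {x t : K} (h : ‖t‖ < ‖x‖) : x ^ 2 - t ^ 2 ≠ 0 := fun hxt =>
  h.ne' ((sq_eq_sq₀ (norm_nonneg x) (norm_nonneg t)).1 (by
    rw [← norm_pow, ← norm_pow, sub_eq_zero.1 hxt]))

variable [IsUltrametricDist K]

theorem norm_one_sub_eq_one {x : K} (hx : ‖x‖ < 1) : ‖1 - x‖ = 1 := by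
  rw [sub_eq_add_neg, IsUltrametricDist.norm_add_eq_max_of_norm_ne_norm (by simpa using hx.ne'),
    norm_neg, norm_one, max_eq_left hx.le]

theorem norm_sub_le_of_norm_le {x y : K} {r : ℝ} (hx : ‖x‖ ≤ r) (hy : ‖y‖ ≤ r) : ‖x - y‖ ≤ r :=
  sub_eq_add_neg x y ▸
    (IsUltrametricDist.norm_add_le_max x (-y)).trans (max_le hx ((norm_neg y).trans_le hy))

variable {δ : ℝ}

theorem norm_prod_one_sub_eq_one {s : Finset ι} {f : ι → K} (hf : ∀ j ∈ s, ‖f j‖ < 1) :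
    ‖∏ j ∈ s, (1 - f j)‖ = 1 := by
  rw [norm_prod]
  exact Finset.prod_eq_one fun j hj => norm_one_sub_eq_one (hf j hj)

theorem norm_prod_one_sub_sub_le {s : Finset ι} {f : ι → K} (hδ0 : 0 ≤ δ) (hδ : δ ≤ 1)
    (hf : ∀ j ∈ s, ‖f j‖ ≤ δ) :
    ‖∏ j ∈ s, (1 - f j) - (1 - ∑ j ∈ s, f j)‖ ≤ δ ^ 2 := by
  induction s using Finset.cons_induction with
  | empty => simpa using sq_nonneg δ
  | cons i s hi ih =>
    rw [Finset.forall_mem_cons] at hf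
    have hs := ih hf.2
    have hsum : ‖∑ j ∈ s, f j‖ ≤ δ :=
      IsUltrametricDist.norm_sum_le_of_forall_le_of_nonneg hδ0 hf.2
    have hprod : ‖∏ j ∈ s, (1 - f j) - 1‖ ≤ δ := by
      rw [show ∏ j ∈ s, (1 - f j) - 1 =
        ∏ j ∈ s, (1 - f j) - (1 - ∑ j ∈ s, f j) - ∑ j ∈ s, f j by ring]
      exact norm_sub_le_of_norm_le (hs.trans (pow_le_of_le_one hδ0 hδ two_ne_zero)) hsum
    rw [Finset.prod_cons, Finset.sum_cons,
      show (1 - f i) * ∏ j ∈ s, (1 - f j) - (1 - (f i + ∑ j ∈ s, f j)) =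
        (∏ j ∈ s, (1 - f j) - (1 - ∑ j ∈ s, f j)) - f i * (∏ j ∈ s, (1 - f j) - 1) by ring]
    refine norm_sub_le_of_norm_le hs ?_
    rw [norm_mul, sq]
    gcongr
    exact hf.1

theorem norm_one_sub_prod_one_sub_le {s : Finset ι} {f : ι → K} (hδ0 : 0 ≤ δ) (hδ : δ ≤ 1)
    (hf : ∀ j ∈ s, ‖f j‖ ≤ δ) : ‖1 - ∏ j ∈ s, (1 - f j)‖ ≤ δ := by
  rw [show 1 - ∏ j ∈ s, (1 - f j) =
    ∑ j ∈ s, f j - (∏ j ∈ s, (1 - f j) - (1 - ∑ j ∈ s, f j)) by ring]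
  exact norm_sub_le_of_norm_le (IsUltrametricDist.norm_sum_le_of_forall_le_of_nonneg hδ0 hf)
    ((norm_prod_one_sub_sub_le hδ0 hδ hf).trans (pow_le_of_le_one hδ0 hδ two_ne_zero))

theorem norm_two_sub_inv_mul_prod_sub_le {s : Finset ι} {f g : ι → K} (hδ0 : 0 ≤ δ) (hδ : δ < 1)
    (hf : ∀ j ∈ s, ‖f j‖ ≤ δ) (hg : ∀ j ∈ s, ‖g j‖ ≤ δ) :
    ‖(2 - (∏ j ∈ s, (1 - f j))⁻¹) * ∏ j ∈ s, (1 - g j) - (1 - ∑ j ∈ s, (f j + g j))‖ ≤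
      δ ^ 2 := by
  have hP : ‖∏ j ∈ s, (1 - f j)‖ = 1 := norm_prod_one_sub_eq_one fun j hj => (hf j hj).trans_lt hδ
  have hQ : ‖∏ j ∈ s, (1 - g j)‖ = 1 := norm_prod_one_sub_eq_one fun j hj => (hg j hj).trans_lt hδ
  have hP0 : ∏ j ∈ s, (1 - f j) ≠ 0 := norm_ne_zero_iff.1 (by rw [hP]; exact one_ne_zero)
  have hfirst := norm_prod_one_sub_sub_le (s := s.disjSum s) (f := Sum.elim f g) hδ0 hδ.le
    (by simpa [or_imp, forall_and] using ⟨hf, hg⟩)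
  simp only [Finset.prod_disjSum, Finset.sum_disjSum, Sum.elim_inl, Sum.elim_inr,
    ← Finset.sum_add_distrib] at hfirst
  have hsplit (P Q S : K) (hP : P ≠ 0) :
      (2 - P⁻¹) * Q - (1 - S) = (P * Q - (1 - S)) - (1 - P) ^ 2 * P⁻¹ * Q := by
    field
  rw [hsplit _ _ _ hP0]
  refine norm_sub_le_of_norm_le hfirst ?_
  rw [norm_mul, norm_mul, norm_inv, hP, hQ, inv_one, mul_one, mul_one, norm_pow]
  gcongr
  exact norm_one_sub_prod_one_sub_le hδ0 hδ.le hf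

end Ultrametric

section Padic

variable {p : ℕ} [Fact p.Prime]

theorem norm_risingFactorial_div_factorial_le_one {x : ℚ_[p]} (hx : ‖x‖ ≤ 1) (n : ℕ) :
    ‖risingFactorial x n / (n.factorial : ℚ_[p])‖ ≤ 1 := by
  obtain ⟨x, rfl⟩ : ∃ z : ℤ_[p], (z : ℚ_[p]) = x := ⟨⟨x, hx⟩, rfl⟩
  have hcast : risingFactorial (x : ℚ_[p]) n = ((ascPochhammer ℤ_[p] n).eval x : ℤ_[p]) := by
    rw [risingFactorial, ← ascPochhammer_map PadicInt.Coe.ringHom, Polynomial.eval_map]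
    exact Polynomial.eval₂_hom _ _
  rw [norm_div, div_le_one (norm_pos_iff.2 (Nat.cast_ne_zero.2 n.factorial_ne_zero)), hcast]
  simpa only [PadicInt.norm_def, PadicInt.coe_natCast] using PadicInt.norm_ascPochhammer_le n x

theorem norm_risingFactorial_succ_div_factorial_le {x : ℚ_[p]} (hx : ‖x‖ ≤ 1) (n : ℕ) :
    ‖risingFactorial x (n + 1) / (n.factorial : ℚ_[p])‖ ≤ ‖x‖ := by
  have hx1 : ‖x + 1‖ ≤ 1 :=
    (IsUltrametricDist.norm_add_le_max x 1).trans (max_le hx norm_one.le)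
  rw [risingFactorial_succ_left, mul_div_assoc, norm_mul]
  exact mul_le_of_le_one_right (norm_nonneg x) (norm_risingFactorial_div_factorial_le_one hx1 n)

/-- The `p`-adically integral combinations of the functions `wellPoised a i`. -/
noncomputable def wellPoisedSpan (a : ℚ_[p]) : Submodule ℤ_[p] (ℚ_[p] → ℚ_[p]) :=
  Submodule.span ℤ_[p] (Set.range (wellPoised a))

variable {a t : ℚ_[p]}

theorem sum_mul_wellPoised_mem {ι : Type*} {s : Finset ι} {c : ι → ℚ_[p]} {e : ι → ℕ}
    (hc : ∀ i ∈ s, ‖c i‖ ≤ 1) :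
    (fun x => ∑ i ∈ s, c i * wellPoised a (e i) x) ∈ wellPoisedSpan a := by
  have hmem : ∑ i ∈ s, (fun x => c i * wellPoised a (e i) x) ∈ wellPoisedSpan a :=
    Submodule.sum_mem _ fun i hi => Submodule.smul_mem (wellPoisedSpan a) (⟨c i, hc i hi⟩ : ℤ_[p])
      (Submodule.subset_span ⟨e i, rfl⟩)
  convert hmem using 1
  ext x
  rw [Finset.sum_apply]

open Finset.HasAntidiagonal in
theorem mul_mem_wellPoisedSpan (ha : ‖a‖ ≤ 1) {f g : ℚ_[p] → ℚ_[p]} (hf : f ∈ wellPoisedSpan a)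
    (hg : g ∈ wellPoisedSpan a) : f * g ∈ wellPoisedSpan a := by
  have hle : wellPoisedSpan a * wellPoisedSpan a ≤ wellPoisedSpan a := by
    rw [wellPoisedSpan, Submodule.span_mul_span, Submodule.span_le]
    rintro _ ⟨_, ⟨i, rfl⟩, _, ⟨j, rfl⟩, rfl⟩
    have hcoeff (h g : ℕ) : ‖wellPoisedMulCoeff a i h g‖ ≤ 1 := by
      have hbase : ‖a + i + h‖ ≤ 1 := by
        rw [add_assoc, ← Nat.cast_add]
        exact (IsUltrametricDist.norm_add_le_max _ _).trans
          (max_le ha (Padic.norm_int_le_one ((i + h : ℕ) : ℤ)))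
      have hsign : ‖(-1 : ℚ_[p]) ^ g‖ ≤ 1 := by simp
      rw [wellPoisedMulCoeff]
      simp only [norm_mul]
      exact mul_le_one₀ (mul_le_one₀ (mul_le_one₀ hsign (norm_nonneg _)
        (Padic.norm_int_le_one (_ : ℕ))) (norm_nonneg _) (Padic.norm_int_le_one (_ : ℕ)))
        (norm_nonneg _) (norm_risingFactorial_div_factorial_le_one hbase g)
    have hmul : wellPoised a i * wellPoised a j = fun x => ∑ q ∈ antidiagonal j,
        wellPoisedMulCoeff a i q.1 q.2 * wellPoised a (i + q.1) x :=
      funext fun x => wellPoised_mul a x i j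
    simp only [hmul, SetLike.mem_coe]
    exact sum_mul_wellPoised_mem fun q _ => hcoeff q.1 q.2
  exact hle (Submodule.mul_mem_mul hf hg)

theorem norm_sum_weight_mul_le (ha : ‖a‖ ≤ 1) {n : ℕ} {μ : ℝ}
    (hμ : ‖(n : ℚ_[p])‖ ≤ μ ∨ ‖a + n - 1‖ ≤ μ) {f : ℚ_[p] → ℚ_[p]} (hf : f ∈ wellPoisedSpan a) :
    ‖∑ k ∈ Finset.range n, (2 * k + a) * f k‖ ≤ μ := by
  have hμ0 : 0 ≤ μ := hμ.elim (norm_nonneg _).trans (norm_nonneg _).trans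
  have hn : ‖(-n : ℚ_[p])‖ ≤ 1 := by
    rw [norm_neg]
    exact Padic.norm_int_le_one (n : ℤ)
  have han : ‖a + n - 1‖ ≤ 1 := by
    rw [add_sub_assoc]
    refine (IsUltrametricDist.norm_add_le_max _ _).trans (max_le ha ?_)
    exact_mod_cast Padic.norm_int_le_one (p := p) (n - 1)
  induction hf using Submodule.span_induction with
  | mem f hf =>
    obtain ⟨i, rfl⟩ := hf
    rw [sum_weight_mul_wellPoised, norm_neg]
    rcases hμ with hμ | hμ
    · rw [mul_div_mul_comm, norm_mul]
      exact (mul_le_of_le_one_right (norm_nonneg _)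
        (norm_risingFactorial_div_factorial_le_one han _)).trans
        ((norm_risingFactorial_succ_div_factorial_le hn i).trans ((norm_neg _).trans_le hμ))
    · rw [mul_comm (risingFactorial _ _), mul_div_mul_comm, norm_mul]
      exact (mul_le_of_le_one_right (norm_nonneg _)
        (norm_risingFactorial_div_factorial_le_one hn _)).trans
        ((norm_risingFactorial_succ_div_factorial_le han i).trans hμ)
  | zero => simpa using hμ0
  | add f g _ _ hf hg =>
    simp only [Pi.add_apply, mul_add, Finset.sum_add_distrib]
    exact (IsUltrametricDist.norm_add_le_max _ _).trans (max_le hf hg)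
  | smul c f _ hf =>
    have hc (k : ℕ) : (2 * k + a) * (c • f) k = c * ((2 * k + a) * f k) :=
      mul_left_comm _ (c : ℚ_[p]) _
    simp only [hc]
    rw [← Finset.mul_sum, norm_mul]
    exact (mul_le_of_le_one_left (norm_nonneg _) c.2).trans hf

theorem norm_le_norm_p_of_lt_one {x : ℚ_[p]} (hx : ‖x‖ < 1) : ‖x‖ ≤ ‖(p : ℚ_[p])‖ := by
  have h := (Padic.norm_le_pow_iff_norm_lt_pow_add_one x (-1)).2 (by simpa using hx)
  rwa [zpow_neg_one, ← Padic.norm_p] at h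

theorem norm_lt_norm_natCast {s l : ℕ} (ht : ‖t‖ ≤ ‖(p : ℚ_[p])‖ ^ s) (hl0 : 0 < l)
    (hl : l < p ^ s) : ‖t‖ < ‖(l : ℚ_[p])‖ := by
  refine ht.trans_lt (lt_of_not_ge fun hle => Nat.not_dvd_of_pos_of_lt hl0 hl ?_)
  have h := (Padic.norm_int_le_pow_iff_dvd (p := p) l s).1
    (by rwa [zpow_neg, zpow_natCast, ← inv_pow, ← Padic.norm_p])
  exact_mod_cast h

theorem norm_sq_div_sq_le {x : ℚ_[p]} (h : ‖t‖ < ‖x‖) :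
    ‖t ^ 2 / x ^ 2‖ ≤ ‖(p : ℚ_[p])‖ ^ 2 := by
  rw [← div_pow, norm_pow]
  gcongr
  refine norm_le_norm_p_of_lt_one ?_
  rwa [norm_div, div_lt_one ((norm_nonneg t).trans_lt h)]

theorem norm_p_sq_lt_one : ‖(p : ℚ_[p])‖ ^ 2 < 1 :=
  pow_lt_one₀ (norm_nonneg _) Padic.norm_p_lt_one two_ne_zero

theorem norm_lt_norm_one_add_natCast {s j : ℕ} (ht : ‖t‖ ≤ ‖(p : ℚ_[p])‖ ^ s)
    (hj : j + 1 < p ^ s) : ‖t‖ < ‖(1 + j : ℚ_[p])‖ := by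
  rw [add_comm]
  exact_mod_cast norm_lt_norm_natCast ht j.succ_pos hj

section Terminating

variable {N s : ℕ} (hNt : a + N = t) (hN : N < p ^ s) (ht : ‖t‖ ≤ ‖(p : ℚ_[p])‖ ^ s)
include hNt hN ht

theorem norm_add_natCast_eq {j : ℕ} (hj : j < N) : ‖a + j‖ = ‖((N - j : ℕ) : ℚ_[p])‖ := by
  have hlt := norm_lt_norm_natCast ht (Nat.sub_pos_of_lt hj) ((N.sub_le j).trans_lt hN)
  have haj : a + j = t + -((N - j : ℕ) : ℚ_[p]) := by
    rw [Nat.cast_sub hj.le, ← hNt]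
    ring
  rw [haj, IsUltrametricDist.norm_add_eq_max_of_norm_ne_norm (by rw [norm_neg]; exact hlt.ne),
    norm_neg, max_eq_right hlt.le]

theorem norm_lt_norm_add_natCast {j : ℕ} (hj : j < N) : ‖t‖ < ‖a + j‖ := by
  rw [norm_add_natCast_eq hNt hN ht hj]
  exact norm_lt_norm_natCast ht (Nat.sub_pos_of_lt hj) ((N.sub_le j).trans_lt hN)

theorem norm_risingFactorial_mul_norm_factorial {i : ℕ} (hi : i ≤ N) :
    ‖risingFactorial a i‖ * ‖((N - i).factorial : ℚ_[p])‖ = ‖(N.factorial : ℚ_[p])‖ := by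
  rw [← Nat.factorial_mul_descFactorial hi, Nat.descFactorial_eq_prod_range,
    risingFactorial_eq_prod, Nat.cast_mul, Nat.cast_prod, norm_mul, norm_prod, norm_prod, mul_comm]
  congr 1
  exact Finset.prod_congr rfl fun j hj =>
    norm_add_natCast_eq hNt hN ht ((Finset.mem_range.1 hj).trans_le hi)

end Terminating

theorem norm_truncTerm_le_one {N s i : ℕ} (ha : ‖a‖ ≤ 1) (hNt : a + N = t) (hN : N < p ^ s)
    (ht : ‖t‖ ≤ ‖(p : ℚ_[p])‖ ^ s) (hi : i ≤ N) : ‖truncTerm a N i‖ ≤ 1 := by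
  have hfac (n : ℕ) : (n.factorial : ℚ_[p]) ≠ 0 := Nat.cast_ne_zero.2 n.factorial_ne_zero
  have hunit : ‖risingFactorial a i * (N - i).factorial / (N.factorial : ℚ_[p])‖ = 1 := by
    rw [norm_div, norm_mul, norm_risingFactorial_mul_norm_factorial hNt hN ht hi,
      div_self (norm_ne_zero_iff.2 (hfac N))]
  have h2a : ‖2 * a + i‖ ≤ 1 := by
    rw [two_mul]
    exact (IsUltrametricDist.norm_add_le_max _ _).trans (max_le
      ((IsUltrametricDist.norm_add_le_max _ _).trans (max_le ha ha)) (Padic.norm_int_le_one i))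
  have h1a : ‖1 - a‖ ≤ 1 := norm_sub_le_of_norm_le norm_one.le ha
  have hsplit : truncTerm a N i =
      (risingFactorial a i * (N - i).factorial / (N.factorial : ℚ_[p])) *
        (risingFactorial (2 * a + i) (N - i) / (N - i).factorial *
          ((risingFactorial a i / i.factorial) ^ 2 *
            (risingFactorial (1 - a) i / i.factorial))) := by
    have := hfac N
    have := hfac i
    have := hfac (N - i)
    rw [truncTerm]
    field
  rw [hsplit, norm_mul, hunit, one_mul, norm_mul, norm_mul, norm_pow]
  exact mul_le_one₀ (norm_risingFactorial_div_factorial_le_one h2a _) (by positivity)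
    (mul_le_one₀ (pow_le_one₀ (norm_nonneg _) (norm_risingFactorial_div_factorial_le_one ha _))
      (norm_nonneg _) (norm_risingFactorial_div_factorial_le_one h1a _))

theorem norm_sum_weight_mul_poisedRatio_mul_two_sub_sub_le {N n s : ℕ} (ha : ‖a‖ ≤ 1)
    (hNt : a + N = t) (hN : N < p ^ s) (ht : ‖t‖ ≤ ‖(p : ℚ_[p])‖ ^ s) (hNn : N < n) :
    ‖∑ k ∈ Finset.range n, (2 * k + a) * (poisedRatio a 0 k * poisedRatio a (t ^ 2) k) *
          (2 * poisedRatio a 0 k - poisedRatio a (t ^ 2) k) -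
        ∑ i ∈ Finset.range (N + 1), truncTerm a N i *
          (t - t ^ 3 * ∑ j ∈ Finset.range i, (1 / (1 + j : ℚ_[p]) ^ 2 + 1 / (a + j) ^ 2))‖ ≤
      ‖(p : ℚ_[p])‖ ^ (s + 4) := by
  have haj {j : ℕ} (hj : j < N) := norm_lt_norm_add_natCast hNt hN ht hj
  have h1j {j : ℕ} (hj : j < N) := norm_lt_norm_one_add_natCast ht (show j + 1 < p ^ s by omega)
  have haj0 {j : ℕ} (hj : j < N) : a + j ≠ 0 := norm_pos_iff.1 ((norm_nonneg t).trans_lt (haj hj))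
  rw [sum_weight_mul_poisedRatio_mul_two_sub hNt hNn (fun j hj => haj0 hj)
    (fun j hj => sq_sub_sq_ne_zero_of_norm_lt (haj hj))
    fun j hj => sq_sub_sq_ne_zero_of_norm_lt (h1j hj), ← Finset.sum_sub_distrib]
  refine IsUltrametricDist.norm_sum_le_of_forall_le_of_nonneg (by positivity) fun i hi => ?_
  have hiN : i ≤ N := Finset.mem_range_succ_iff.1 hi
  have hlt {j : ℕ} (hj : j ∈ Finset.range i) : j < N := (Finset.mem_range.1 hj).trans_le hiN
  have hbracket := norm_two_sub_inv_mul_prod_sub_le (sq_nonneg _) norm_p_sq_lt_one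
    (fun j hj => norm_sq_div_sq_le (h1j (hlt hj))) fun j hj => norm_sq_div_sq_le (haj (hlt hj))
  have hsum : t - t ^ 3 * ∑ j ∈ Finset.range i, (1 / (1 + j : ℚ_[p]) ^ 2 + 1 / (a + j) ^ 2) =
      t * (1 - ∑ j ∈ Finset.range i, (t ^ 2 / (1 + j : ℚ_[p]) ^ 2 + t ^ 2 / (a + j) ^ 2)) := by
    simp only [div_eq_mul_one_div (t ^ 2), ← mul_add, ← Finset.mul_sum]
    ring
  rw [hsum, mul_left_comm (truncTerm a N i) t, ← mul_sub, ← mul_sub, norm_mul, norm_mul, pow_add]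
  refine mul_le_mul ht ((mul_le_of_le_one_left (norm_nonneg _)
    (norm_truncTerm_le_one ha hNt hN ht hiN)).trans (hbracket.trans_eq ?_))
    (by positivity) (by positivity)
  ring

theorem norm_saalCoeff_le_one (ha : ‖a‖ ≤ 1) (i : ℕ) : ‖saalCoeff a 0 i‖ ≤ 1 := by
  rw [saalCoeff_zero_right]
  exact norm_risingFactorial_div_factorial_le_one (norm_sub_le_of_norm_le norm_one.le ha) i

theorem norm_saalCoeff_sub_le {s i : ℕ} (ha : ‖a‖ ≤ 1) (ht : ‖t‖ ≤ ‖(p : ℚ_[p])‖ ^ s)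
    (hi : i < p ^ s) : ‖saalCoeff a 0 i - saalCoeff a (t ^ 2) i‖ ≤ ‖(p : ℚ_[p])‖ ^ 2 := by
  have hf : ∀ j ∈ Finset.range i, ‖t ^ 2 / (1 + j : ℚ_[p]) ^ 2‖ ≤ ‖(p : ℚ_[p])‖ ^ 2 := fun j hj =>
    norm_sq_div_sq_le (norm_lt_norm_one_add_natCast ht
      ((Nat.succ_le_of_lt (Finset.mem_range.1 hj)).trans_lt hi))
  have hP := norm_prod_one_sub_eq_one fun j hj => (hf j hj).trans_lt norm_p_sq_lt_one
  have hP0 := norm_ne_zero_iff.1 (hP.trans_ne one_ne_zero)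
  have hsub := norm_one_sub_prod_one_sub_le (sq_nonneg _) norm_p_sq_lt_one.le hf
  rw [saalCoeff_eq_mul_inv_prod a (t ^ 2), ← mul_one_sub, norm_mul, norm_sub_rev 1, ← one_div,
    div_sub_one hP0, norm_div, hP, div_one]
  exact (mul_le_of_le_one_left (norm_nonneg _) (norm_saalCoeff_le_one ha i)).trans hsub

theorem norm_sum_weight_mul_poisedRatio_mul_sub_sq_le {n s : ℕ} (ha : ‖a‖ ≤ 1)
    (ht : ‖t‖ ≤ ‖(p : ℚ_[p])‖ ^ s) (hn : n ≤ p ^ s)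
    (hμ : ‖(n : ℚ_[p])‖ ≤ ‖(p : ℚ_[p])‖ ^ s ∨ ‖a + n - 1‖ ≤ ‖(p : ℚ_[p])‖ ^ s) :
    ‖∑ k ∈ Finset.range n, (2 * k + a) *
        (poisedRatio a 0 k * (poisedRatio a 0 k - poisedRatio a (t ^ 2) k) ^ 2)‖ ≤
      ‖(p : ℚ_[p])‖ ^ (s + 4) := by
  have hp0 : (p : ℚ_[p]) ^ 2 ≠ 0 :=
    pow_ne_zero 2 (Nat.cast_ne_zero.2 (Fact.out : p.Prime).ne_zero)
  let c (i : ℕ) : ℚ_[p] := (saalCoeff a 0 i - saalCoeff a (t ^ 2) i) / (p : ℚ_[p]) ^ 2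
  let F : ℚ_[p] → ℚ_[p] := fun x => ∑ i ∈ Finset.range n, saalCoeff a 0 i * wellPoised a i x
  let D : ℚ_[p] → ℚ_[p] := fun x => ∑ i ∈ Finset.range n, c i * wellPoised a i x
  have hF : F ∈ wellPoisedSpan a := sum_mul_wellPoised_mem fun i _ => norm_saalCoeff_le_one ha i
  have hD : D ∈ wellPoisedSpan a := sum_mul_wellPoised_mem fun i hi => by
    rw [norm_div, norm_pow, div_le_one (by rw [← norm_pow]; exact norm_pos_iff.2 hp0)]
    exact norm_saalCoeff_sub_le ha ht ((Finset.mem_range.1 hi).trans_le hn)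
  have hF_eq : ∀ k ∈ Finset.range n, poisedRatio a 0 k = F k := fun k hk =>
    poisedRatio_eq_sum (Finset.mem_range.1 hk) fun j _ => by
      rw [sub_zero, add_comm]; exact pow_ne_zero 2 j.cast_add_one_ne_zero
  have hD_eq : ∀ k ∈ Finset.range n,
      poisedRatio a 0 k - poisedRatio a (t ^ 2) k = (p : ℚ_[p]) ^ 2 * D k := fun k hk => by
    rw [hF_eq k hk, poisedRatio_eq_sum (Finset.mem_range.1 hk) fun j hj =>
      sq_sub_sq_ne_zero_of_norm_lt (norm_lt_norm_one_add_natCast ht (hj.trans_le hn)),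
      ← Finset.sum_sub_distrib, Finset.mul_sum]
    exact Finset.sum_congr rfl fun i _ => by
      rw [← sub_mul, ← mul_assoc, mul_div_cancel₀ _ hp0]
  have hsum := norm_sum_weight_mul_le ha hμ
    (mul_mem_wellPoisedSpan ha hF (mul_mem_wellPoisedSpan ha hD hD))
  calc _ = ‖(p : ℚ_[p]) ^ 4 * ∑ k ∈ Finset.range n, (2 * k + a) * (F * (D * D)) k‖ := by
        rw [Finset.mul_sum]
        congr 1
        refine Finset.sum_congr rfl fun k hk => ?_
        rw [hD_eq k hk, hF_eq k hk, Pi.mul_apply, Pi.mul_apply]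
        ring
    _ ≤ _ := by
        rw [norm_mul, norm_pow, pow_add, mul_comm]
        gcongr

/-- With `F = (a)_k² / k!²` and its deformation `G = poisedRatio a (t²)`, which vanishes beyond
`k = N`, the series of `F³` is split along `F³ = F G (2F - G) + F (F - G)²`. -/
theorem norm_sum_weight_mul_pow_six_sub_le {N n s : ℕ} (ha : ‖a‖ ≤ 1) (hNt : a + N = t)
    (ht : ‖t‖ ≤ ‖(p : ℚ_[p])‖ ^ s) (hNn : N < n) (hn : n ≤ p ^ s)
    (hμ : ‖(n : ℚ_[p])‖ ≤ ‖(p : ℚ_[p])‖ ^ s ∨ ‖a + n - 1‖ ≤ ‖(p : ℚ_[p])‖ ^ s) :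
    ‖∑ k ∈ Finset.range n, (2 * k + a) * (risingFactorial a k / (k.factorial : ℚ_[p])) ^ 6 -
        ∑ i ∈ Finset.range (N + 1), truncTerm a N i *
          (t - t ^ 3 * ∑ j ∈ Finset.range i, (1 / (1 + j : ℚ_[p]) ^ 2 + 1 / (a + j) ^ 2))‖ ≤
      ‖(p : ℚ_[p])‖ ^ (s + 4) := by
  have hsplit : ∑ k ∈ Finset.range n,
      (2 * k + a) * (risingFactorial a k / (k.factorial : ℚ_[p])) ^ 6 =
      ∑ k ∈ Finset.range n, (2 * k + a) *
        (poisedRatio a 0 k * (poisedRatio a 0 k - poisedRatio a (t ^ 2) k) ^ 2) +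
      ∑ k ∈ Finset.range n, (2 * k + a) * (poisedRatio a 0 k * poisedRatio a (t ^ 2) k) *
        (2 * poisedRatio a 0 k - poisedRatio a (t ^ 2) k) := by
    rw [← Finset.sum_add_distrib]
    refine Finset.sum_congr rfl fun k _ => ?_
    rw [show 6 = 2 * 3 from rfl, pow_mul, ← poisedRatio_zero_right]
    ring
  rw [hsplit, add_sub_assoc]
  exact (IsUltrametricDist.norm_add_le_max _ _).trans (max_le
    (norm_sum_weight_mul_poisedRatio_mul_sub_sq_le ha ht hn hμ)
    (norm_sum_weight_mul_poisedRatio_mul_two_sub_sub_le ha hNt (hNn.trans_le hn) ht hNn))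

end Padic

section Transfer

theorem ratCast_risingFactorial {K : Type*} [Field K] [CharZero K] (x : ℚ) (n : ℕ) :
    ((risingFactorial x n : ℚ) : K) = risingFactorial (x : K) n := by
  simp [risingFactorial_eq_prod]

theorem ratCast_truncTerm {K : Type*} [Field K] [CharZero K] (a : ℚ) (N i : ℕ) :
    ((truncTerm a N i : ℚ) : K) = truncTerm (a : K) N i := by
  simp [truncTerm, ratCast_risingFactorial]

theorem ratCongr_of_norm_le {p e : ℕ} [Fact p.Prime] {x y : ℚ}
    (h : ‖((x - y : ℚ) : ℚ_[p])‖ ≤ ‖(p : ℚ_[p])‖ ^ e) : RatCongr p e x y := by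
  have hp0 : (p : ℚ) ^ e ≠ 0 := pow_ne_zero e (Nat.cast_ne_zero.2 (Fact.out : p.Prime).ne_zero)
  have hp0' : 0 < ‖(p : ℚ_[p])‖ ^ e :=
    pow_pos (norm_pos_iff.2 (Nat.cast_ne_zero.2 (Fact.out : p.Prime).ne_zero)) e
  set q : ℚ := (x - y) / (p : ℚ) ^ e with hq
  have hqint : ‖(q : ℚ_[p])‖ ≤ 1 := by
    rw [hq, Rat.cast_div, Rat.cast_pow, Rat.cast_natCast, norm_div, norm_pow]
    exact (div_le_one hp0').2 h
  refine ⟨q.num, q.den, fun hdvd => ?_, ?_⟩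
  · have hden := PadicInt.isUnit_iff.1 (PadicInt.isUnit_den q hqint)
    rw [PadicInt.norm_natCast_eq_one_iff] at hden
    exact (Fact.out : p.Prime).coprime_iff_not_dvd.1 hden (by exact_mod_cast hdvd)
  · rw [Int.cast_natCast, Rat.num_div_den, hq, mul_div_cancel₀ _ hp0]

theorem sum_Icc_inv_sq_eq {d : ℚ} (hd : d ≠ 0) (r : ℚ) (k : ℕ) :
    ∑ j ∈ Finset.Icc 1 k, (1 / (d * j) ^ 2 + 1 / (d * j - d + r) ^ 2) =
      1 / d ^ 2 * ∑ j ∈ Finset.range k, (1 / (1 + j : ℚ) ^ 2 + 1 / (r / d + j) ^ 2) := by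
  rw [← Finset.Ico_add_one_right_eq_Icc, Finset.sum_Ico_eq_sum_range, Nat.add_sub_cancel,
    Finset.mul_sum]
  refine Finset.sum_congr rfl fun j _ => ?_
  have hsecond : d * ((1 + j : ℕ) : ℚ) - d + r = d * (r / d + j) := by
    push_cast
    field
  rw [hsecond, mul_pow, mul_pow]
  push_cast
  simp only [one_div, mul_inv, mul_add]

theorem sum_mul_pow_six_eq {d : ℚ} (hd : d ≠ 0) (r : ℚ) (n : ℕ) :
    ∑ k ∈ Finset.range n, (2 * d * k + r) *
        (shiftedFactorial (r / d) k ^ 6 / (k.factorial : ℚ) ^ 6) =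
      d * ∑ k ∈ Finset.range n,
        (2 * k + r / d) * (risingFactorial (r / d) k / (k.factorial : ℚ)) ^ 6 := by
  rw [Finset.mul_sum]
  refine Finset.sum_congr rfl fun k _ => ?_
  rw [show shiftedFactorial (r / d) k = risingFactorial (r / d) k from rfl, ← div_pow, ← mul_assoc,
    mul_add, mul_div_cancel₀ r hd]
  ring

theorem sum_truncated_eq {d : ℚ} (hd : d ≠ 0) (r P : ℚ) (N : ℕ) :
    1 / shiftedFactorial 1 N * ∑ k ∈ Finset.range (N + 1),
        shiftedFactorialQuot (2 * r / d) N k *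
          (shiftedFactorial (r / d) k ^ 3 * shiftedFactorial (1 - r / d) k /
            (k.factorial : ℚ) ^ 3) *
          (P - P ^ 3 *
            ∑ j ∈ Finset.Icc 1 k, (1 / (d * j) ^ 2 + 1 / (d * j - d + r) ^ 2)) =
      d * ∑ i ∈ Finset.range (N + 1), truncTerm (r / d) N i *
        (P / d - (P / d) ^ 3 *
          ∑ j ∈ Finset.range i, (1 / (1 + j : ℚ) ^ 2 + 1 / (r / d + j) ^ 2)) := by
  have hfac : shiftedFactorial 1 N = N.factorial := risingFactorial_one N
  rw [hfac, Finset.mul_sum, Finset.mul_sum]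
  refine Finset.sum_congr rfl fun i _ => ?_
  have hquot : shiftedFactorialQuot (2 * r / d) N i =
      risingFactorial (2 * (r / d) + i) (N - i) := by
    rw [← mul_div_assoc]
    rfl
  rw [sum_Icc_inv_sq_eq hd, hquot, truncTerm,
    show shiftedFactorial = risingFactorial from rfl]
  field

end Transfer

theorem corollary5p3_general (p d s : ℕ) (r : ℤ) (hp : p.Prime) (hpd : Nat.gcd p d = 1) (N : ℕ)
    (hN : N < p ^ s) (hdvd : (p : ℤ) ^ s ∣ r + d * N) (m : ℕ) (hm : m = N ∨ m = p ^ s - 1) :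
    RatCongr p (s + 4)
      (∑ k ∈ Finset.range (m + 1),
        (2 * (d : ℚ) * (k : ℚ) + (r : ℚ)) *
          (shiftedFactorial ((r : ℚ) / (d : ℚ)) k ^ 6 / (Nat.factorial k : ℚ) ^ 6))
      (1 / shiftedFactorial 1 N *
        ∑ k ∈ Finset.range (N + 1),
          shiftedFactorialQuot (2 * (r : ℚ) / (d : ℚ)) N k *
            (shiftedFactorial ((r : ℚ) / (d : ℚ)) k ^ 3 *
              shiftedFactorial (1 - (r : ℚ) / (d : ℚ)) k / (Nat.factorial k : ℚ) ^ 3) *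
            (((r : ℚ) + d * N) - ((r : ℚ) + d * N) ^ 3 *
              ∑ j ∈ Finset.Icc 1 k,
                (1 / ((d : ℚ) * (j : ℚ)) ^ 2 +
                  1 / ((d : ℚ) * (j : ℚ) - (d : ℚ) + (r : ℚ)) ^ 2))) := by
  have : Fact p.Prime := ⟨hp⟩
  have hdnorm : ‖(d : ℚ_[p])‖ = 1 := Padic.norm_natCast_eq_one_iff.2 hpd
  have hd0 : (d : ℚ) ≠ 0 := by
    rintro h
    simp [Nat.cast_eq_zero.1 h] at hdnorm
  have ha : ‖(r : ℚ_[p]) / d‖ ≤ 1 := by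
    rw [norm_div, hdnorm, div_one]
    exact Padic.norm_int_le_one r
  have ht : ‖((r : ℚ_[p]) + d * N) / d‖ ≤ ‖(p : ℚ_[p])‖ ^ s := by
    rw [norm_div, hdnorm, div_one, Padic.norm_p, inv_pow, ← zpow_natCast, ← zpow_neg]
    exact_mod_cast (Padic.norm_int_le_pow_iff_dvd (p := p) (r + d * N) s).2
      (by exact_mod_cast hdvd)
  have hd0' : (d : ℚ_[p]) ≠ 0 := by exact_mod_cast hd0
  have hNt : (r : ℚ_[p]) / d + N = (r + d * N) / d := by field
  have hrange : N < m + 1 ∧ m + 1 ≤ p ^ s := by omega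
  have hedge : ‖((m + 1 : ℕ) : ℚ_[p])‖ ≤ ‖(p : ℚ_[p])‖ ^ s ∨
      ‖(r : ℚ_[p]) / d + (m + 1 : ℕ) - 1‖ ≤ ‖(p : ℚ_[p])‖ ^ s := by
    rcases hm with rfl | rfl
    · right
      rwa [Nat.cast_add_one, add_sub_assoc, add_sub_cancel_right, hNt]
    · left
      rw [Nat.sub_add_cancel (by omega), Nat.cast_pow, norm_pow]
  have hcore := norm_sum_weight_mul_pow_six_sub_le ha hNt ht hrange.1 hrange.2 hedge
  refine ratCongr_of_norm_le ?_
  rw [sum_mul_pow_six_eq hd0, sum_truncated_eq hd0, ← mul_sub, Rat.cast_mul, norm_mul,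
    Rat.cast_natCast, hdnorm, one_mul]
  simpa [ratCast_risingFactorial, ratCast_truncTerm] using hcore

theorem corollary5p3 (p d s : ℕ) (r : ℤ) (hp : p.Prime) (hp2 : p ≠ 2) (hd : 0 < d) (hs : 0 < s)
    (hr₁ : (d : ℤ) + (p : ℤ) ^ s - (d : ℤ) * (p : ℤ) ^ s ≤ r) (hr₂ : r ≤ (p : ℤ) ^ s)
    (hpd : Nat.gcd p d = 1) (hmod : (p : ℤ) ^ s ≡ r [ZMOD (d : ℤ)])
    (N : ℕ) (hN : (N : ℤ) = ((p : ℤ) ^ s - r) / (d : ℤ))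
    (m : ℕ) (hm : m = N ∨ m = p ^ s - 1) :
    RatCongr p (s + 4)
      (∑ k ∈ Finset.range (m + 1),
        (2 * (d : ℚ) * (k : ℚ) + (r : ℚ)) *
          (shiftedFactorial ((r : ℚ) / (d : ℚ)) k ^ 6 / (Nat.factorial k : ℚ) ^ 6))
      (1 / shiftedFactorial 1 N *
        ∑ k ∈ Finset.range (N + 1),
          shiftedFactorialQuot (2 * (r : ℚ) / (d : ℚ)) N k *
            (shiftedFactorial ((r : ℚ) / (d : ℚ)) k ^ 3 *
              shiftedFactorial (1 - (r : ℚ) / (d : ℚ)) k / (Nat.factorial k : ℚ) ^ 3) *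
            ((p : ℚ) ^ s - (p : ℚ) ^ (3 * s) *
              ∑ j ∈ Finset.Icc 1 k,
                (1 / ((d : ℚ) * (j : ℚ)) ^ 2 +
                  1 / ((d : ℚ) * (j : ℚ) - (d : ℚ) + (r : ℚ)) ^ 2))) := by
  have hP : r + d * N = (p : ℤ) ^ s := by
    rw [hN, Int.mul_ediv_cancel' hmod.symm.dvd, add_sub_cancel]
  have hPQ : (r : ℚ) + d * N = (p : ℚ) ^ s := by exact_mod_cast hP
  have hNlt : N < p ^ s := by
    have h : (d : ℤ) * (N + 1) ≤ d * (p : ℤ) ^ s := by linarith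
    exact_mod_cast le_of_mul_le_mul_left h (by exact_mod_cast hd)
  simpa only [hPQ, ← pow_mul'] using
    corollary5p3_general p d s r hp hpd N hNlt (hP ▸ dvd_rfl) m hm
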